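/- Fix $\beta>0$, $h\in\mathbb R$, $0<p<\tfrac12$ and $S\in(-1,1)$. For each $n$ in an unbounded sequence of population sizes tending to infinity such that $n(1+S)/2$ is not an integer, let $G_n$ be a graph on $n$ vertices with adjacency matrix $A_n$, and let $\boldsymbol X=(X_1,\dots,X_n)\in\{-1,1\}^n$ have the Ising distribution $$\mathbb P(\boldsymbol X=\boldsymbol x)=\frac{\exp(\beta\,\boldsymbol x^TA_n\boldsymbol x+h\,\boldsymbol 1^T\boldsymbol x)}{Z_n(\beta,h)},\qquad Z_n(\beta,h)=\sum_{\boldsymbol x\in\{-1,1\}^n}\exp(\beta\,\boldsymbol x^TA_n\boldsymbol x+h\,\boldsymbol 1^T\boldsymbol x).$$ Let $\boldsymbol Y=(Y_1,\dots,Y_n)\in\{-1,1\}^n$ be the output of a binary symmetric channel with cross-over probability $p$ and input $\boldsymbol X$: given $\boldsymbol X$, the $Y_i$ are independent, with $Y_i=X_i$ with probability $1-p$ and $Y_i=-X_i$ with probability $p$. Write $\overline{X_n}=\frac1n\sum_i X_i$, $\overline{Y_n}=\frac1n\sum_i Y_i$, and let $$P_e^{(n)}=\mathbb P\bigl(\operatorname{sign}(\overline{X_n}-S)\neq\operatorname{sign}(\overline{Y_n}-(1-2p)S)\bigr),$$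 where $\operatorname{sign}(0)=0$. Put $D_p=\frac{1-2p}{\sqrt{4p(1-p)}}$ and $Q(x)=\frac1{\sqrt{2\pi}}\int_x^\infty e^{-t^2/2}\,dt$. All limits are taken as $n\to\infty$ along the given sequence of sizes. (a) If $\sqrt n(\overline{X_n}-S)$ converges in distribution to a probability distribution $\Phi$ on $\mathbb R$, then $$\lim_{n\to\infty}P_e^{(n)}=\int_{-\infty}^{\infty}Q(D_p|x|)\,\Phi(dx).$$ (b) In particular, if $\sqrt n(\overline{X_n}-S)$ converges in distribution to $N(0,\sigma^2)$ with $\sigma\ge 0$, then $$\lim_{n\to\infty}P_e^{(n)}=\frac1\pi\operatorname{arccot}(D_p\sigma)>0,$$ where $\operatorname{arccot}$ takes values in $(0,\pi)$ and $N(0,0)$ is the point mass at $0$. -/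

import Mathlib

open MeasureTheory ProbabilityTheory Filter
open scoped Topology NNReal Matrix

noncomputable section

namespace Sentiment

/-- The real vector of a configuration of sentiments; a sentiment is an element of `ℤˣ = {-1, 1}`. -/
def toReal {n : ℕ} (x : Fin n → ℤˣ) : Fin n → ℝ := fun i => ((x i : ℤ) : ℝ)

/-- The average `(1/n) ∑ᵢ xᵢ`. -/
def avg {n : ℕ} (x : Fin n → ℤˣ) : ℝ := (∑ i, toReal x i) / n

open Classical in
/-- The unnormalized Ising weight `exp (β xᵀ A x + h 1ᵀ x)`, with `A` the adjacency matrix of `G`. -/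
def isingWeight {n : ℕ} (G : SimpleGraph (Fin n)) (β h : ℝ) (x : Fin n → ℤˣ) : ℝ :=
  Real.exp (β * (toReal x ⬝ᵥ (G.adjMatrix ℝ *ᵥ toReal x)) + h * (1 ⬝ᵥ toReal x))

/-- The partition function. -/
def partitionFunction {n : ℕ} (G : SimpleGraph (Fin n)) (β h : ℝ) : ℝ :=
  ∑ x : Fin n → ℤˣ, isingWeight G β h x

/-- The probability mass function of the Ising Markov random field. -/
def isingProb {n : ℕ} (G : SimpleGraph (Fin n)) (β h : ℝ) (x : Fin n → ℤˣ) : ℝ :=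
  isingWeight G β h x / partitionFunction G β h

/-- Transition probabilities of the binary symmetric channel with cross-over probability `p`. -/
def bscProb (p : ℝ) (a b : ℤˣ) : ℝ := if b = a then 1 - p else p

/-- Under `P`, the sentiments `X` follow the Ising prior, and the measured sentiments `Y` are,
conditionally on `X`, independent outputs of binary symmetric channels with inputs `Xᵢ`. -/
structure IsNoisyIsing {n : ℕ} {Ω : Type*} [MeasurableSpace Ω] (P : Measure Ω)
    (X Y : Ω → Fin n → ℤˣ) (G : SimpleGraph (Fin n)) (β h p : ℝ) : Prop where
  measurable_sentiment : Measurable X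
  measurable_measured : Measurable Y
  prior : ∀ x, P.real {ω | X ω = x} = isingProb G β h x
  channel : ∀ x y, P.real {ω | X ω = x ∧ Y ω = y}
    = P.real {ω | X ω = x} * ∏ i, bscProb p (x i) (y i)

/-- The supermajority sentiment with threshold `S`. -/
def supermajority {n : ℕ} (S : ℝ) (x : Fin n → ℤˣ) : SignType := SignType.sign (avg x - S)

/-- The naive detector of the supermajority sentiment from the measured sentiments. -/
def detector {n : ℕ} (p S : ℝ) (y : Fin n → ℤˣ) : SignType :=
  SignType.sign (avg y - (1 - 2 * p) * S)

/-- The detection error probability. -/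
def errorProb {n : ℕ} {Ω : Type*} [MeasurableSpace Ω] (P : Measure Ω)
    (X Y : Ω → Fin n → ℤˣ) (p S : ℝ) : ℝ :=
  P.real {ω | supermajority S (X ω) ≠ detector p S (Y ω)}

/-- The tail probability of the standard normal distribution. -/
def gaussianTail (x : ℝ) : ℝ :=
  1 / √(2 * Real.pi) * ∫ t in Set.Ioi x, Real.exp (-t ^ 2 / 2)

/-- The constant `D_p = (1 - 2p) / √(4p(1-p))`. -/
def channelConst (p : ℝ) : ℝ := (1 - 2 * p) / √(4 * p * (1 - p))

/-- The inverse cotangent, with values in `(0, π)`. -/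
def arccot (x : ℝ) : ℝ := Real.pi / 2 - Real.arctan x

end Sentiment

end

/-! Given `X = x`, put `u = √n (avg x - S)` and let `W` be the channel noise normalized to variance
1. Up to a positive factor the detector sees `W + D_p u`. Non-integrality of `n(1+S)/2` forces `u ≠
0`, so an error means that `W` lies in a closed half-line at distance `D_p |u|` from 0.

For (a), `W` is asymptotically standard normal for every choice of inputs (`tendsto_noiseLaw`). The
half-line moves with `n`, but convergence to a law with bounded density is uniform over half-lines
(`eventually_forall_abs_sub_le`). Hence the conditional error is `Q(D_p |u|) + o(1)` uniformly in
`x`, and averaging over `X` gives `P_e = E Q(D_p |u|) + o(1)`. As `Q(D_p |·|)` is bounded and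
continuous, weak convergence of `u` gives the limit.

For (b), `a ↦ ∫ Q(a|z|) dN(0,1)` has derivative `-1/(π(1+a²))` and value `1/2` at 0, so it equals
`arccot a / π`; scaling by `σ` finishes. -/

noncomputable section

namespace Sentiment

/-! ### The channel noise and its central limit theorem -/

/-- The probability that the channel with input `x` outputs `y`. -/
def channelProb {n : ℕ} (p : ℝ) (x y : Fin n → ℤˣ) : ℝ := ∏ i, bscProb p (x i) (y i)

lemma bscProb_nonneg {p : ℝ} (hp0 : 0 < p) (hp : p < 1 / 2) (a b : ℤˣ) : 0 ≤ bscProb p a b := by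
  unfold bscProb; split_ifs <;> linarith

lemma channelProb_nonneg {n : ℕ} {p : ℝ} (hp0 : 0 < p) (hp : p < 1 / 2) (x y : Fin n → ℤˣ) :
    0 ≤ channelProb p x y := Finset.prod_nonneg fun _ _ => bscProb_nonneg hp0 hp _ _

lemma sum_units_int {M : Type*} [AddCommMonoid M] (f : ℤˣ → M) (a : ℤˣ) :
    ∑ b, f b = f a + f (-a) := by
  rcases Int.units_eq_one_or a with rfl | rfl
  · rw [show (Finset.univ : Finset ℤˣ) = {1, -1} from rfl, Finset.sum_pair (by decide)]
  · rw [show (Finset.univ : Finset ℤˣ) = {1, -1} from rfl, Finset.sum_pair (by decide), neg_neg,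
      add_comm]

lemma bscProb_self (p : ℝ) (a : ℤˣ) : bscProb p a a = 1 - p := by simp [bscProb]

lemma bscProb_neg (p : ℝ) (a : ℤˣ) : bscProb p a (-a) = p := by
  rcases Int.units_eq_one_or a with rfl | rfl <;> simp [bscProb, show (1 : ℤˣ) ≠ -1 by decide,
    show (-1 : ℤˣ) ≠ 1 by decide]

lemma sum_channelProb {n : ℕ} (p : ℝ) (x : Fin n → ℤˣ) : ∑ y, channelProb p x y = 1 := by
  unfold channelProb
  rw [← Fintype.prod_sum (fun i b => bscProb p (x i) b)]
  refine Finset.prod_eq_one fun i _ => ?_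
  rw [sum_units_int _ (x i), bscProb_self, bscProb_neg]
  ring

/-- The normalized channel noise `∑ᵢ (yᵢ - (1 - 2p) xᵢ) / √(4p(1-p)n)`. -/
def noise {n : ℕ} (p : ℝ) (x y : Fin n → ℤˣ) : ℝ :=
  ∑ i, (toReal y i - (1 - 2 * p) * toReal x i) / √(4 * p * (1 - p) * n)

/-- The law of the normalized noise of the channel with input `x`. -/
def noiseLaw {n : ℕ} (p : ℝ) (x : Fin n → ℤˣ) : Measure ℝ :=
  ∑ y, ENNReal.ofReal (channelProb p x y) • Measure.dirac (noise p x y)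

lemma isProbabilityMeasure_noiseLaw {n : ℕ} {p : ℝ} (hp0 : 0 < p) (hp : p < 1 / 2)
    (x : Fin n → ℤˣ) : IsProbabilityMeasure (noiseLaw p x) := by
  constructor
  simp only [noiseLaw, Measure.coe_finsetSum, Measure.coe_smul, Finset.sum_apply, Pi.smul_apply,
    measure_univ, smul_eq_mul, mul_one]
  rw [← ENNReal.ofReal_sum_of_nonneg fun y _ => channelProb_nonneg hp0 hp x y, sum_channelProb,
    ENNReal.ofReal_one]

open Classical in
lemma noiseLaw_real {n : ℕ} {p : ℝ} (hp0 : 0 < p) (hp : p < 1 / 2) (x : Fin n → ℤˣ)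
    {s : Set ℝ} (hs : MeasurableSet s) :
    (noiseLaw p x).real s = ∑ y, if noise p x y ∈ s then channelProb p x y else 0 := by
  simp only [noiseLaw, Measure.real, Measure.coe_finsetSum, Measure.coe_smul, Finset.sum_apply,
    Pi.smul_apply, smul_eq_mul, Measure.dirac_apply' _ hs]
  rw [ENNReal.toReal_sum (fun y _ => by
    by_cases h : noise p x y ∈ s <;> simp [h])]
  refine Finset.sum_congr rfl fun y _ => ?_
  by_cases h : noise p x y ∈ s <;> simp [h, channelProb_nonneg hp0 hp x y]

/-- The characteristic function of the centered channel noise of a single member. -/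
def bscCharFun (p s : ℝ) : ℂ :=
  (1 - p) * Complex.exp (2 * p * s * Complex.I)
    + p * Complex.exp (-(2 * (1 - p) * s * Complex.I))

/-- Independence factors the sum over outputs. Flipping an input reflects its centered noise, so `x
i` enters only as the sign of the argument. -/
lemma charFun_noiseLaw {n : ℕ} {p : ℝ} (hp0 : 0 < p) (hp : p < 1 / 2) (x : Fin n → ℤˣ) (t : ℝ) :
    charFun (noiseLaw p x) t
      = ∏ i, bscCharFun p (toReal x i * (t / √(4 * p * (1 - p) * n))) := by
  have h1 : charFun (noiseLaw p x) t = ∑ y, (channelProb p x y : ℂ)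
      * Complex.exp (t * noise p x y * Complex.I) := by
    rw [charFun_apply_real, noiseLaw, integral_finsetSum_measure]
    · refine Finset.sum_congr rfl fun y _ => ?_
      rw [integral_smul_measure, integral_dirac,
        ENNReal.toReal_ofReal (channelProb_nonneg hp0 hp x y), Complex.real_smul]
    · intro y _
      exact (integrable_dirac (by simp)).smul_measure (by simp)
  rw [h1]
  have h2 : ∀ i, bscCharFun p (toReal x i * (t / √(4 * p * (1 - p) * n)))
      = ∑ b : ℤˣ, (bscProb p (x i) b : ℂ) * Complex.exp (t * ((((b : ℤ) : ℝ)
        - (1 - 2 * p) * toReal x i) / √(4 * p * (1 - p) * n) : ℝ) * Complex.I) := by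
    intro i
    rw [sum_units_int _ (x i), bscProb_self, bscProb_neg, bscCharFun]
    congr 2
    · push_cast; rfl
    · congr 1; simp only [toReal]; push_cast; ring
    · congr 1; simp only [toReal]; push_cast; ring
  simp_rw [h2]
  rw [Fintype.prod_sum]
  refine Finset.sum_congr rfl fun y _ => ?_
  rw [Finset.prod_mul_distrib, ← Complex.exp_sum, channelProb, noise]
  congr 1
  · push_cast; rfl
  · push_cast
    rw [Finset.mul_sum, Finset.sum_mul]
    rfl

/-- Replace the factors one at a time; those left over have norm at most 1. -/
lemma norm_prod_sub_prod_le {ι : Type*} (s : Finset ι) (a b : ι → ℂ) (ha : ∀ i, ‖a i‖ ≤ 1)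
    (hb : ∀ i, ‖b i‖ ≤ 1) : ‖∏ i ∈ s, a i - ∏ i ∈ s, b i‖ ≤ ∑ i ∈ s, ‖a i - b i‖ := by
  classical
  induction s using Finset.induction_on with
  | empty => simp
  | insert j s hj ih =>
    rw [Finset.prod_insert hj, Finset.prod_insert hj, Finset.sum_insert hj]
    have hB : ‖∏ i ∈ s, b i‖ ≤ 1 := by
      rw [norm_prod]
      exact Finset.prod_le_one (fun _ _ => norm_nonneg _) fun i _ => hb i
    calc ‖a j * ∏ i ∈ s, a i - b j * ∏ i ∈ s, b i‖
        = ‖(a j - b j) * ∏ i ∈ s, b i + a j * (∏ i ∈ s, a i - ∏ i ∈ s, b i)‖ := by congr 1; ring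
      _ ≤ ‖a j - b j‖ * ‖∏ i ∈ s, b i‖ + ‖a j‖ * ‖∏ i ∈ s, a i - ∏ i ∈ s, b i‖ := by
          rw [← norm_mul, ← norm_mul]; exact norm_add_le _ _
      _ ≤ ‖a j - b j‖ * 1 + 1 * ∑ i ∈ s, ‖a i - b i‖ := by
          gcongr
          exact ha j
      _ = _ := by ring

lemma norm_bscCharFun_le_one {p : ℝ} (hp0 : 0 < p) (hp : p < 1 / 2) (s : ℝ) :
    ‖bscCharFun p s‖ ≤ 1 := by
  have e1 : ‖Complex.exp (2 * p * s * Complex.I)‖ = 1 := by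
    have := Complex.norm_exp_ofReal_mul_I (2 * p * s); push_cast at this; exact this
  have e2 : ‖Complex.exp (-(2 * (1 - p) * s * Complex.I))‖ = 1 := by
    have := Complex.norm_exp_ofReal_mul_I (-(2 * (1 - p) * s)); push_cast at this
    rw [← this]; congr 2; ring
  have e3 : ‖(1 - p : ℂ)‖ = 1 - p := by
    rw [← Complex.ofReal_one, ← Complex.ofReal_sub, Complex.norm_real, Real.norm_of_nonneg]
    linarith
  have e4 : ‖(p : ℂ)‖ = p := by rw [Complex.norm_real, Real.norm_of_nonneg hp0.le]
  calc ‖bscCharFun p s‖ ≤ _ := norm_add_le _ _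
    _ = 1 := by rw [norm_mul, norm_mul, e1, e2, e3, e4]; ring

/-- Second-order Taylor expansion. In the constant 3, the averaged remainders of the two channel
exponentials contribute 2 and the Gaussian factor 1. -/
lemma norm_bscCharFun_sub_exp_le {p : ℝ} (hp0 : 0 < p) (hp : p < 1 / 2) {s : ℝ}
    (hs : |s| ≤ 1 / 2) :
    ‖bscCharFun p s - Complex.exp (-(4 * p * (1 - p) * s ^ 2 / 2 : ℝ))‖ ≤ 3 * |s| ^ 3 := by
  have hs0 := abs_nonneg s
  have key : ∀ r : ℝ, |r| ≤ 2 →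
      ‖Complex.exp (r * s * Complex.I) - (1 + r * s * Complex.I - (r * s) ^ 2 / 2)‖
        ≤ 2 * |s| ^ 3 := by
    intro r hr
    have hn : ‖(r * s * Complex.I : ℂ)‖ = |r| * |s| := by simp
    have hle : |r| * |s| ≤ 1 := by nlinarith [abs_nonneg r]
    -- The remainder constant is `4 / (3! * 3) = 2/9`, and `8 * (2/9) ≤ 2`.
    have := Complex.exp_bound (x := r * s * Complex.I) (by rw [hn]; exact hle)
      (n := 3) (by norm_num)
    rw [hn] at this
    simp only [Finset.sum_range_succ, Finset.range_zero, Finset.sum_empty] at this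
    norm_num [Nat.factorial] at this
    calc _ = ‖Complex.exp (r * s * Complex.I)
          - (1 + r * s * Complex.I + (r * s * Complex.I) ^ 2 / 2)‖ := by
          congr 2
          rw [mul_pow _ Complex.I, Complex.I_sq]; ring
      _ ≤ (|r| * |s|) ^ 3 * (2 / 9) := this
      _ ≤ (2 * |s|) ^ 3 * (2 / 9) := by gcongr
      _ ≤ _ := by nlinarith [pow_nonneg hs0 3]
  have k1 := key (2 * p) (by rw [abs_of_nonneg (by linarith)]; linarith)
  have k2 := key (-(2 * (1 - p))) (by rw [abs_neg, abs_of_nonneg (by linarith)]; linarith)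
  have k3 : ‖Complex.exp (-(4 * p * (1 - p) * s ^ 2 / 2 : ℝ))
      - (1 + -(4 * p * (1 - p) * s ^ 2 / 2 : ℝ))‖ ≤ |s| ^ 3 := by
    have hv0 : 0 ≤ 4 * p * (1 - p) := by nlinarith
    have hv : 4 * p * (1 - p) ≤ 1 := by nlinarith [sq_nonneg (1 - 2 * p)]
    have hz : ‖(-(4 * p * (1 - p) * s ^ 2 / 2 : ℝ) : ℂ)‖ ≤ |s| ^ 2 / 2 := by
      rw [norm_neg, Complex.norm_real, Real.norm_of_nonneg (by positivity), sq_abs]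
      nlinarith [sq_nonneg s]
    have hz1 : ‖(-(4 * p * (1 - p) * s ^ 2 / 2 : ℝ) : ℂ)‖ ≤ 1 := by nlinarith
    rw [← sub_sub]
    refine (Complex.norm_exp_sub_one_sub_id_le hz1).trans ?_
    calc _ ≤ (|s| ^ 2 / 2) ^ 2 := by gcongr
      _ = |s| ^ 3 * (|s| / 4) := by ring
      _ ≤ |s| ^ 3 * 1 := by gcongr; linarith
      _ = _ := mul_one _
  set A := Complex.exp ((2 * p : ℝ) * s * Complex.I)
    - (1 + (2 * p : ℝ) * s * Complex.I - ((2 * p : ℝ) * s) ^ 2 / 2) with hA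
  set B := Complex.exp ((-(2 * (1 - p)) : ℝ) * s * Complex.I)
    - (1 + (-(2 * (1 - p)) : ℝ) * s * Complex.I - ((-(2 * (1 - p)) : ℝ) * s) ^ 2 / 2) with hB
  set C := Complex.exp (-(4 * p * (1 - p) * s ^ 2 / 2 : ℝ))
      - (1 + -(4 * p * (1 - p) * s ^ 2 / 2 : ℝ)) with hC
  -- The noise has mean 0 and variance `4p(1-p)`, so all terms up to second order cancel.
  have e : bscCharFun p s - Complex.exp (-(4 * p * (1 - p) * s ^ 2 / 2 : ℝ))
      = ((1 - p : ℝ) : ℂ) * A + (p : ℂ) * B - C := by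
    rw [hA, hB, hC, bscCharFun]
    push_cast
    rw [show -(2 * (1 - (p : ℂ)) * s * Complex.I) = -(2 * (1 - p)) * s * Complex.I by ring]
    ring
  rw [e]
  calc _ ≤ ‖((1 - p : ℝ) : ℂ) * A‖ + ‖(p : ℂ) * B‖ + ‖C‖ :=
        (norm_sub_le _ _).trans (by gcongr; exact norm_add_le _ _)
    _ ≤ (1 - p) * (2 * |s| ^ 3) + p * (2 * |s| ^ 3) + |s| ^ 3 := by
        rw [norm_mul, norm_mul, Complex.norm_real, Complex.norm_real,
          Real.norm_of_nonneg (by linarith), Real.norm_of_nonneg hp0.le]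
        gcongr
        linarith
    _ = _ := by ring

lemma abs_toReal {n : ℕ} (x : Fin n → ℤˣ) (i : Fin n) : |toReal x i| = 1 := by
  rcases Int.units_eq_one_or (x i) with h | h <;> simp [toReal, h]

/-- The Gaussian characteristic function is split into `n` equal factors and compared factor by
factor. Since `|x i| = 1`, the bound does not depend on `x`. -/
lemma norm_charFun_noiseLaw_sub_le {n : ℕ} {p : ℝ} (hp0 : 0 < p) (hp : p < 1 / 2)
    (x : Fin n → ℤˣ) {t : ℝ} (hn : n ≠ 0) (ht : |t / √(4 * p * (1 - p) * n)| ≤ 1 / 2) :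
    ‖charFun (noiseLaw p x) t - Complex.exp (-(t ^ 2 / 2 : ℝ))‖
      ≤ n * (3 * |t / √(4 * p * (1 - p) * n)| ^ 3) := by
  have hn' : (0 : ℝ) < n := by positivity
  have hv0 : 0 < 4 * p * (1 - p) := by nlinarith
  set s := t / √(4 * p * (1 - p) * n) with hs
  have e : Complex.exp (-(t ^ 2 / 2 : ℝ))
      = ∏ _i : Fin n, Complex.exp (-(4 * p * (1 - p) * s ^ 2 / 2 : ℝ)) := by
    rw [Finset.prod_const, Finset.card_univ, Fintype.card_fin, ← Complex.exp_nat_mul]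
    congr 1
    have : t ^ 2 / 2 = n * (4 * p * (1 - p) * s ^ 2 / 2) := by
      rw [hs, div_pow, Real.sq_sqrt (by positivity)]
      have : 1 - p ≠ 0 := by linarith
      field_simp
    rw [this]; push_cast; ring
  rw [charFun_noiseLaw hp0 hp, e]
  refine (norm_prod_sub_prod_le _ _ _ (fun i => norm_bscCharFun_le_one hp0 hp _) fun i => ?_).trans
    ?_
  · rw [← Complex.ofReal_neg, ← Complex.ofReal_exp, Complex.norm_real,
      Real.norm_of_nonneg (Real.exp_pos _).le, Real.exp_le_one_iff, neg_nonpos]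
    positivity
  · have hbd : ∀ i ∈ Finset.univ, ‖bscCharFun p (toReal x i * s)
        - Complex.exp (-(4 * p * (1 - p) * s ^ 2 / 2 : ℝ))‖ ≤ 3 * |s| ^ 3 := by
      intro i _
      have habs : |toReal x i * s| = |s| := by rw [abs_mul, abs_toReal, one_mul]
      have hsq : (toReal x i * s) ^ 2 = s ^ 2 := by rw [← sq_abs, habs, sq_abs]
      have := norm_bscCharFun_sub_exp_le hp0 hp (s := toReal x i * s) (by rw [habs]; exact ht)
      rwa [habs, hsq] at this
    refine (Finset.sum_le_card_nsmul _ _ _ hbd).trans ?_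
    rw [Finset.card_univ, Fintype.card_fin, nsmul_eq_mul]

/-- The normalized channel noise is asymptotically standard normal, whatever the inputs are. -/
lemma tendsto_noiseLaw {p : ℝ} (hp0 : 0 < p) (hp : p < 1 / 2) {N : ℕ → ℕ}
    (hN : Tendsto N atTop atTop) (x : ∀ k, Fin (N k) → ℤˣ) :
    Tendsto (β := ProbabilityMeasure ℝ)
      (fun k => ⟨noiseLaw p (x k), isProbabilityMeasure_noiseLaw hp0 hp (x k)⟩) atTop
      (𝓝 ⟨gaussianReal 0 1, inferInstance⟩) := by
  refine ProbabilityMeasure.tendsto_iff_tendsto_charFun.2 fun t => ?_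
  simp only [ProbabilityMeasure.coe_mk, charFun_gaussianReal]
  have hv0 : 0 < 4 * p * (1 - p) := by nlinarith
  have hNr : Tendsto (fun k => √(N k : ℝ)) atTop atTop :=
    Real.tendsto_sqrt_atTop.comp (tendsto_natCast_atTop_atTop.comp hN)
  set c := √(4 * p * (1 - p)) with hc
  have hc0 : 0 < c := Real.sqrt_pos.2 hv0
  have hs : Tendsto (fun k => |t / √(4 * p * (1 - p) * N k)|) atTop (𝓝 0) := by
    have : Tendsto (fun k => t / (c * √(N k : ℝ))) atTop (𝓝 0) :=
      tendsto_const_nhds.div_atTop (hNr.const_mul_atTop hc0)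
    simpa [hc, Real.sqrt_mul hv0.le] using this.abs
  have hb : Tendsto (fun k => t ^ 2 / c ^ 2 * (3 * |t / √(4 * p * (1 - p) * N k)|)) atTop (𝓝 0) := by
    simpa using (hs.const_mul 3).const_mul (t ^ 2 / c ^ 2)
  rw [tendsto_iff_norm_sub_tendsto_zero]
  refine squeeze_zero' (Eventually.of_forall fun _ => norm_nonneg _) ?_ hb
  filter_upwards [hN.eventually_ge_atTop 1, hs.eventually_le_const (show (0 : ℝ) < 1 / 2 by norm_num)]
    with k hk hk2
  have hk' : (0 : ℝ) < N k := by exact_mod_cast hk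
  have := norm_charFun_noiseLaw_sub_le hp0 hp (x k) (by omega) hk2
  -- With `s` the quantity in absolute value, `n s² = t²/c²`; one factor `|s| → 0` is left.
  have e2 : (N k : ℝ) * (3 * |t / √(4 * p * (1 - p) * N k)| ^ 3)
      = t ^ 2 / c ^ 2 * (3 * |t / √(4 * p * (1 - p) * N k)|) := by
    rw [pow_succ |_| 2, sq_abs, div_pow, Real.sq_sqrt (by positivity), hc, Real.sq_sqrt hv0.le]
    field_simp
  rw [e2] at this
  have e3 : (t * (0 : ℝ) * Complex.I - ((1 : ℝ≥0) : ℝ) * t ^ 2 / 2 : ℂ) = -(t ^ 2 / 2 : ℝ) := by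
    push_cast; ring
  rwa [e3]

/-! ### Weak convergence to the standard normal law is uniform on half-lines -/

/-- The density is at most `1/√(2π) ≤ 1`. -/
lemma gaussianReal_Icc_le (a b : ℝ) (hab : a ≤ b) : (gaussianReal 0 1).real (Set.Icc a b) ≤ b - a := by
  have hle : ∀ x, gaussianPDFReal 0 1 x ≤ 1 := by
    intro x
    rw [gaussianPDFReal_def]
    have h1 : (√(2 * Real.pi * (1 : ℝ≥0)))⁻¹ ≤ 1 := by
      apply inv_le_one_of_one_le₀
      rw [Real.one_le_sqrt]
      have := Real.pi_gt_three
      simp only [NNReal.coe_one]; linarith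
    have h2 : Real.exp (-(x - 0) ^ 2 / (2 * (1 : ℝ≥0))) ≤ 1 := by
      rw [Real.exp_le_one_iff, neg_div, neg_nonpos]; positivity
    calc _ ≤ 1 * (1 : ℝ) := mul_le_mul h1 h2 (Real.exp_pos _).le zero_le_one
      _ = 1 := one_mul 1
  rw [Measure.real, gaussianReal_apply_eq_integral _ one_ne_zero, ENNReal.toReal_ofReal
    (setIntegral_nonneg measurableSet_Icc fun x _ => gaussianPDFReal_nonneg _ _ _)]
  calc _ ≤ ∫ x in Set.Icc a b, (1 : ℝ) := by
        refine setIntegral_mono (integrable_gaussianPDFReal 0 1).integrableOn ?_ hle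
        simp
    _ = b - a := by simp [hab]

lemma gaussianReal_thickening_Iic_le (t : ℝ) {ε : ℝ} (hε : 0 ≤ ε) :
    (gaussianReal 0 1).real (Metric.thickening ε (Set.Iic t))
      ≤ (gaussianReal 0 1).real (Set.Iic t) + ε := by
  have hsub : Metric.thickening ε (Set.Iic t) ⊆ Set.Iic t ∪ Set.Icc t (t + ε) := by
    intro y hy
    obtain ⟨z, hz, hd⟩ := Metric.mem_thickening_iff.1 hy
    rw [Real.dist_eq, abs_lt] at hd
    rcases le_total y t with h | h
    · exact Or.inl h
    · exact Or.inr ⟨h, by have : z ≤ t := hz; linarith [hd.2]⟩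
  refine (measureReal_mono hsub).trans ((measureReal_union_le _ _).trans ?_)
  have := gaussianReal_Icc_le t (t + ε) (by linarith)
  linarith

lemma gaussianReal_thickening_Ici_le (t : ℝ) {ε : ℝ} (hε : 0 ≤ ε) :
    (gaussianReal 0 1).real (Metric.thickening ε (Set.Ici t))
      ≤ (gaussianReal 0 1).real (Set.Ici t) + ε := by
  have hsub : Metric.thickening ε (Set.Ici t) ⊆ Set.Ici t ∪ Set.Icc (t - ε) t := by
    intro y hy
    obtain ⟨z, hz, hd⟩ := Metric.mem_thickening_iff.1 hy
    rw [Real.dist_eq, abs_lt] at hd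
    rcases le_total t y with h | h
    · exact Or.inl h
    · exact Or.inr ⟨by have : t ≤ z := hz; linarith [hd.1], h⟩
  refine (measureReal_mono hsub).trans ((measureReal_union_le _ _).trans ?_)
  have := gaussianReal_Icc_le (t - ε) t (by linarith)
  linarith

/-- One `ε` is the Lévy–Prokhorov error, the other the mass gained by thickening `B`. -/
lemma measureReal_le_of_levyProkhorovEDist_lt {μ : Measure ℝ} [IsProbabilityMeasure μ] {ε : ℝ}
    (hε : 0 < ε) (h : levyProkhorovEDist μ (gaussianReal 0 1) < ENNReal.ofReal ε) {B : Set ℝ}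
    (hB : MeasurableSet B) (hG : (gaussianReal 0 1).real (Metric.thickening ε B)
      ≤ (gaussianReal 0 1).real B + ε) :
    μ.real B ≤ (gaussianReal 0 1).real B + 2 * ε := by
  have h1 := left_measure_le_of_levyProkhorovEDist_lt h hB
  rw [ENNReal.toReal_ofReal hε.le] at h1
  have h2 : μ.real B ≤ (gaussianReal 0 1).real (Metric.thickening ε B) + ε := by
    have := ENNReal.toReal_mono (by finiteness) h1
    rwa [ENNReal.toReal_add (by finiteness) (by finiteness), ENNReal.toReal_ofReal hε.le] at this
  linarith

/-- If the Lévy–Prokhorov distance of `μ` to the standard normal law is small, then so is the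
difference of the masses of any closed half-line. -/
lemma abs_sub_le_of_levyProkhorovEDist_lt {μ : Measure ℝ} [IsProbabilityMeasure μ] {ε : ℝ}
    (hε : 0 < ε) (h : levyProkhorovEDist μ (gaussianReal 0 1) < ENNReal.ofReal ε) (t : ℝ) :
    |μ.real (Set.Iic t) - (gaussianReal 0 1).real (Set.Iic t)| ≤ 2 * ε ∧
    |μ.real (Set.Ici t) - (gaussianReal 0 1).real (Set.Ici t)| ≤ 2 * ε := by
  have := nullSingletonClass_gaussianReal (μ := 0) (v := 1) one_ne_zero
  have hIic := measureReal_le_of_levyProkhorovEDist_lt hε h measurableSet_Iic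
    (gaussianReal_thickening_Iic_le t hε.le)
  have hIci := measureReal_le_of_levyProkhorovEDist_lt hε h measurableSet_Ici
    (gaussianReal_thickening_Ici_le t hε.le)
  -- Lower bounds follow from the upper bounds on the opposite half-lines. `μ` may have an atom at
  -- `t`, so its two masses only sum to at least 1.
  have hG : (gaussianReal 0 1).real (Set.Iic t) + (gaussianReal 0 1).real (Set.Ici t) = 1 := by
    rw [measureReal_congr Ioi_ae_eq_Ici.symm, ← Set.compl_Iic, probReal_compl_eq_one_sub
      measurableSet_Iic]
    ring
  have hμ : 1 ≤ μ.real (Set.Iic t) + μ.real (Set.Ici t) := by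
    rw [← probReal_univ (μ := μ), ← Set.Iic_union_Ici (a := t)]
    exact measureReal_union_le _ _
  constructor <;> rw [abs_le] <;> constructor <;> linarith

lemma eventually_forall_abs_sub_le {μ : ℕ → ProbabilityMeasure ℝ}
    (hμ : Tendsto μ atTop (𝓝 ⟨gaussianReal 0 1, inferInstance⟩)) {ε : ℝ} (hε : 0 < ε) :
    ∀ᶠ k in atTop, ∀ t : ℝ,
      |(μ k : Measure ℝ).real (Set.Iic t) - (gaussianReal 0 1).real (Set.Iic t)| ≤ ε ∧
      |(μ k : Measure ℝ).real (Set.Ici t) - (gaussianReal 0 1).real (Set.Ici t)| ≤ ε := by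
  have h := (LevyProkhorov.probabilityMeasureHomeomorph.continuous.tendsto _).comp hμ
  rw [EMetric.tendsto_nhds] at h
  filter_upwards [h (ENNReal.ofReal (ε / 2)) (by simpa using hε)] with k hk t
  have := abs_sub_le_of_levyProkhorovEDist_lt (μ := (μ k : Measure ℝ)) (half_pos hε) hk t
  rwa [mul_div_cancel₀ _ two_ne_zero] at this

/-! ### The Gaussian tail -/

lemma integrable_exp_neg_sq_div_two : Integrable fun t : ℝ => Real.exp (-t ^ 2 / 2) := by
  refine (integrable_exp_neg_mul_sq (b := 1 / 2) (by norm_num)).congr (.of_forall fun t => ?_)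
  simp only; congr 1; ring

lemma gaussianTail_eq_measureReal_Ici (x : ℝ) :
    gaussianTail x = (gaussianReal 0 1).real (Set.Ici x) := by
  rw [Measure.real, gaussianReal_apply_eq_integral _ one_ne_zero, ENNReal.toReal_ofReal
    (setIntegral_nonneg measurableSet_Ici fun x _ => gaussianPDFReal_nonneg _ _ _),
    integral_Ici_eq_integral_Ioi, gaussianTail, ← integral_const_mul]
  refine setIntegral_congr_fun measurableSet_Ioi fun t _ => ?_
  simp [gaussianPDFReal_def]

lemma gaussianTail_eq_measureReal_Iic_neg (x : ℝ) :
    gaussianTail x = (gaussianReal 0 1).real (Set.Iic (-x)) := by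
  have h : (gaussianReal 0 1).map (fun x => -x) = gaussianReal 0 1 := by
    simpa using gaussianReal_map_neg (μ := 0) (v := 1)
  rw [gaussianTail_eq_measureReal_Ici, ← h, map_measureReal_apply measurable_neg measurableSet_Ici,
    h]
  congr 1
  ext y
  simp

lemma gaussianTail_nonneg (x : ℝ) : 0 ≤ gaussianTail x := by
  rw [gaussianTail_eq_measureReal_Ici]; exact measureReal_nonneg

lemma gaussianTail_le_one (x : ℝ) : gaussianTail x ≤ 1 := by
  rw [gaussianTail_eq_measureReal_Ici]; exact measureReal_le_one

lemma hasDerivAt_gaussianTail (x : ℝ) :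
    HasDerivAt gaussianTail (-(1 / √(2 * Real.pi) * Real.exp (-x ^ 2 / 2))) x := by
  have hcont : Continuous fun t : ℝ => Real.exp (-t ^ 2 / 2) := by fun_prop
  have e : gaussianTail = fun x => 1 / √(2 * Real.pi) *
      ((∫ t in Set.Ioi (0 : ℝ), Real.exp (-t ^ 2 / 2)) - ∫ t in (0 : ℝ)..x, Real.exp (-t ^ 2 / 2)) := by
    ext x
    rw [gaussianTail, ← intervalIntegral.integral_interval_add_Ioi (a := 0) (b := x)
      integrable_exp_neg_sq_div_two.integrableOn integrable_exp_neg_sq_div_two.integrableOn]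
    ring
  rw [e, ← mul_neg]
  refine HasDerivAt.const_mul _ ?_
  rw [← zero_sub]
  exact (hasDerivAt_const x _).sub (intervalIntegral.integral_hasDerivAt_right
    (hcont.intervalIntegrable _ _) (hcont.stronglyMeasurableAtFilter _ _) hcont.continuousAt)

lemma continuous_gaussianTail : Continuous gaussianTail :=
  continuous_iff_continuousAt.2 fun x => (hasDerivAt_gaussianTail x).continuousAt

lemma continuous_gaussianTail_mul_abs (D : ℝ) : Continuous fun x : ℝ => gaussianTail (D * |x|) :=
  continuous_gaussianTail.comp (by fun_prop)

lemma gaussianTail_zero : gaussianTail 0 = 1 / 2 := by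
  have h := integral_gaussian_Ioi (1 / 2)
  have e : ∀ t : ℝ, Real.exp (-t ^ 2 / 2) = Real.exp (-(1 / 2) * t ^ 2) := fun t => by ring_nf
  simp only [gaussianTail, e, h]
  rw [show Real.pi / (1 / 2) = 2 * Real.pi by ring]
  have : √(2 * Real.pi) ≠ 0 := by positivity
  field_simp

lemma integral_Ioi_mul_exp_neg_mul_sq {b : ℝ} (hb : 0 < b) :
    ∫ r in Set.Ioi (0 : ℝ), r * Real.exp (-b * r ^ 2) = (2 * b)⁻¹ := by
  have h := integral_mul_cexp_neg_mul_sq (b := b) (by simpa using hb)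
  apply Complex.ofReal_injective
  rw [← integral_complex_ofReal]
  push_cast
  exact h

/-- The two Gaussian factors merge into `exp (-(1 + a²) z² / 2)`, and the weight `|z|` makes the
integral elementary. -/
lemma integral_deriv_gaussianTail (a : ℝ) :
    ∫ z, -(1 / √(2 * Real.pi) * Real.exp (-(a * |z|) ^ 2 / 2)) * |z| ∂(gaussianReal 0 1)
      = -(1 / Real.pi * (1 / (1 + a ^ 2))) := by
  have hpos : (0 : ℝ) < (1 + a ^ 2) / 2 := by positivity
  rw [integral_gaussianReal_eq_integral_smul one_ne_zero]
  have e : ∀ z : ℝ, gaussianPDFReal 0 1 z •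
      (-(1 / √(2 * Real.pi) * Real.exp (-(a * |z|) ^ 2 / 2)) * |z|)
      = (fun r : ℝ => -(1 / (2 * Real.pi)) * (r * Real.exp (-((1 + a ^ 2) / 2) * r ^ 2))) |z| := by
    intro z
    have hs : √(2 * Real.pi) * √(2 * Real.pi) = 2 * Real.pi :=
      Real.mul_self_sqrt (by positivity)
    have hexp : Real.exp (-((1 + a ^ 2) / 2) * |z| ^ 2)
        = Real.exp (-z ^ 2 / 2) * Real.exp (-(a * |z|) ^ 2 / 2) := by
      rw [← Real.exp_add]; congr 1
      rw [mul_pow, sq_abs]; ring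
    simp only [gaussianPDFReal_def, hexp, smul_eq_mul, sub_zero, NNReal.coe_one, mul_one]
    field_simp
    rw [sq, hs]
  rw [integral_congr_ae (.of_forall e), integral_comp_abs
    (f := fun r : ℝ => -(1 / (2 * Real.pi)) * (r * Real.exp (-((1 + a ^ 2) / 2) * r ^ 2))),
    integral_const_mul, integral_Ioi_mul_exp_neg_mul_sq hpos]
  field_simp

/-- Differentiation under the integral; the derivative is dominated by `|z| / √(2π)` for every `a`.
-/
lemma hasDerivAt_integral_gaussianTail (a : ℝ) :
    HasDerivAt (fun a => ∫ z, gaussianTail (a * |z|) ∂(gaussianReal 0 1))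
      (-(1 / Real.pi * (1 / (1 + a ^ 2)))) a := by
  rw [← integral_deriv_gaussianTail]
  have hint : Integrable (fun z : ℝ => 1 / √(2 * Real.pi) * |z|) (gaussianReal 0 1) :=
    ((memLp_id_gaussianReal (μ := 0) (v := 1) 1).integrable (by simp)).abs.const_mul _
  refine (hasDerivAt_integral_of_dominated_loc_of_deriv_le (s := Set.univ)
    (F' := fun a z => -(1 / √(2 * Real.pi) * Real.exp (-(a * |z|) ^ 2 / 2)) * |z|)
    (bound := fun z : ℝ => 1 / √(2 * Real.pi) * |z|) univ_mem
    (.of_forall fun b => ?_) ?_ ?_ ?_ hint ?_).2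
  · exact (continuous_gaussianTail_mul_abs _).aestronglyMeasurable
  · refine Integrable.of_bound
      (continuous_gaussianTail_mul_abs _).aestronglyMeasurable 1 (.of_forall fun z => ?_)
    rw [Real.norm_of_nonneg (gaussianTail_nonneg _)]
    exact gaussianTail_le_one _
  · exact Continuous.aestronglyMeasurable (by fun_prop)
  · refine .of_forall fun z b _ => ?_
    rw [norm_mul, norm_neg, norm_mul, Real.norm_of_nonneg (Real.exp_pos _).le, Real.norm_eq_abs |z|,
      abs_abs, Real.norm_of_nonneg (by positivity)]
    gcongr
    refine mul_le_of_le_one_right (by positivity) ?_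
    rw [Real.exp_le_one_iff, neg_div, neg_nonpos]
    positivity
  · refine .of_forall fun z b _ => ?_
    have h := (hasDerivAt_gaussianTail (b * |z|)).comp b ((hasDerivAt_id b).mul_const |z|)
    rw [one_mul] at h
    exact h

lemma integral_gaussianTail (a : ℝ) :
    ∫ z, gaussianTail (a * |z|) ∂(gaussianReal 0 1) = 1 / Real.pi * arccot a := by
  have hd : ∀ b : ℝ, HasDerivAt (fun a => (∫ z, gaussianTail (a * |z|) ∂(gaussianReal 0 1))
      + 1 / Real.pi * Real.arctan a) 0 b := fun b => by
    have h := (hasDerivAt_integral_gaussianTail b).add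
      ((Real.hasDerivAt_arctan b).const_mul (1 / Real.pi))
    rw [neg_add_cancel] at h
    exact h
  have h := is_const_of_deriv_eq_zero (fun b => (hd b).differentiableAt)
    (fun b => (hd b).deriv) a 0
  simp only [zero_mul, gaussianTail_zero, Real.arctan_zero, mul_zero, add_zero, integral_const,
    probReal_univ, one_smul] at h
  have hpi := Real.pi_ne_zero
  rw [arccot, mul_sub]
  have : 1 / Real.pi * (Real.pi / 2) = 1 / 2 := by field_simp
  linarith

/-- `N(0, σ²)` is the image of `N(0, 1)` under `z ↦ σ z`, also for `σ = 0`. -/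
lemma integral_gaussianTail_gaussianReal (D : ℝ) (σ : ℝ≥0) :
    ∫ x, gaussianTail (D * |x|) ∂(gaussianReal 0 (σ ^ 2)) = 1 / Real.pi * arccot (D * σ) := by
  have h : gaussianReal 0 (σ ^ 2) = (gaussianReal 0 1).map (fun x => (σ : ℝ) * x) := by
    rw [gaussianReal_map_const_mul]
    congr 1
    · simp
    · ext; simp
  rw [h, integral_map (by fun_prop)
    (continuous_gaussianTail_mul_abs _).aestronglyMeasurable, ← integral_gaussianTail]
  simp [abs_mul, mul_assoc]

lemma arccot_pos (x : ℝ) : 0 < arccot x := sub_pos.2 (Real.arctan_lt_pi_div_two x)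

/-! ### The conditional error probability given the sentiments -/

/-- The noises for which the detector errs, if the normalized excess of the sentiments is `u`. -/
def errorSet (p u : ℝ) : Set ℝ :=
  {w | SignType.sign u ≠ SignType.sign (w + channelConst p * u)}

/-- The half-line is closed because a detector output of 0 counts as an error. -/
lemma errorSet_of_pos {p u : ℝ} (hu : 0 < u) : errorSet p u = Set.Iic (-(channelConst p * |u|)) := by
  ext w
  rw [errorSet, Set.mem_ofPred_eq, sign_pos hu, ne_comm, Ne, sign_eq_one_iff, Set.mem_Iic,
    abs_of_pos hu, not_lt, le_neg_iff_add_nonpos_right]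

lemma errorSet_of_neg {p u : ℝ} (hu : u < 0) : errorSet p u = Set.Ici (channelConst p * |u|) := by
  ext w
  rw [errorSet, Set.mem_ofPred_eq, sign_neg hu, ne_comm, Ne, sign_eq_neg_one_iff, Set.mem_Ici,
    abs_of_neg hu, not_lt, mul_neg, neg_le_iff_add_nonneg]

lemma measurableSet_errorSet {p u : ℝ} (hu : u ≠ 0) : MeasurableSet (errorSet p u) := by
  rcases hu.lt_or_gt with h | h
  · rw [errorSet_of_neg h]; exact measurableSet_Ici
  · rw [errorSet_of_pos h]; exact measurableSet_Iic

/-- The normalized excess `√n (avg x - S)`. -/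
def excess {n : ℕ} (S : ℝ) (x : Fin n → ℤˣ) : ℝ := √(n : ℝ) * (avg x - S)

/-- `n (1 + avg x) / 2` counts the entries equal to 1, so it is an integer and `avg x ≠ S`. The
choice `m = 0` excludes `n = 0`. -/
lemma excess_ne_zero {n : ℕ} {S : ℝ} (hn : ∀ m : ℤ, (n : ℝ) * (1 + S) / 2 ≠ m)
    (x : Fin n → ℤˣ) : excess S x ≠ 0 := by
  have hn0 : (n : ℝ) ≠ 0 := fun h => hn 0 (by simp [h])
  intro h
  rcases mul_eq_zero.1 h with h | h
  · exact hn0 (by simpa using h)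
  have hS : S = avg x := by linarith
  have hone : ∀ i, (toReal x i + 1) / 2 = ((if x i = 1 then 1 else 0 : ℤ) : ℝ) := by
    intro i
    rcases Int.units_eq_one_or (x i) with h | h <;>
      simp [toReal, h, show (-1 : ℤˣ) ≠ 1 by decide]
  refine hn (∑ i, if x i = 1 then 1 else 0) ?_
  rw [Int.cast_sum, ← Finset.sum_congr rfl fun i _ => hone i, ← Finset.sum_div,
    Finset.sum_add_distrib, hS, avg]
  simp only [Finset.sum_const, Finset.card_univ, Fintype.card_fin, nsmul_eq_mul, mul_one]
  field_simp
  ring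

lemma noise_mem_errorSet_iff {n : ℕ} {p S : ℝ} (hp0 : 0 < p) (hp : p < 1 / 2) (hn : n ≠ 0)
    (x y : Fin n → ℤˣ) :
    noise p x y ∈ errorSet p (excess S x) ↔ supermajority S x ≠ detector p S y := by
  have hv0 : 0 < 4 * p * (1 - p) := by nlinarith
  have hn' : (0 : ℝ) < n := by positivity
  have hc : 0 < √(4 * p * (1 - p)) := Real.sqrt_pos.2 hv0
  have hsn : 0 < √(n : ℝ) := Real.sqrt_pos.2 hn'
  have h1 : SignType.sign (excess S x) = supermajority S x := by
    rw [excess, sign_mul, sign_pos hsn, one_mul, supermajority]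
  have h2 : SignType.sign (noise p x y + channelConst p * excess S x) = detector p S y := by
    -- The positive factor does not affect the sign.
    have e : noise p x y + channelConst p * excess S x
        = √(n : ℝ) / √(4 * p * (1 - p)) * (avg y - (1 - 2 * p) * S) := by
      rw [noise, ← Finset.sum_div, Finset.sum_sub_distrib, ← Finset.mul_sum, channelConst, excess,
        avg, avg, Real.sqrt_mul hv0.le]
      have hsq : (n : ℝ) = √(n : ℝ) * √(n : ℝ) := (Real.mul_self_sqrt hn'.le).symm
      set r := √(n : ℝ)
      rw [hsq]
      field_simp
      ring
    rw [e, sign_mul, sign_pos (div_pos hsn hc), one_mul, detector]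
  rw [errorSet, Set.mem_ofPred_eq, h1, h2]

/-- The conditional error probability is close to the Gaussian tail, uniformly in the sentiments. -/
lemma eventually_forall_abs_noiseLaw_sub_le {p S : ℝ} (hp0 : 0 < p) (hp : p < 1 / 2) {N : ℕ → ℕ}
    (hN : Tendsto N atTop atTop) (hNS : ∀ k, ∀ m : ℤ, (N k : ℝ) * (1 + S) / 2 ≠ m)
    {ε : ℝ} (hε : 0 < ε) :
    ∀ᶠ k in atTop, ∀ x : Fin (N k) → ℤˣ, |(noiseLaw p x).real (errorSet p (excess S x))
      - gaussianTail (channelConst p * |excess S x|)| ≤ ε := by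
  -- Uniformity in `x`: for each `k` take the worst of the finitely many configurations; the central
  -- limit theorem applies to any such sequence.
  have hmax : ∀ k, ∃ x : Fin (N k) → ℤˣ, ∀ y : Fin (N k) → ℤˣ,
      |(noiseLaw p y).real (errorSet p (excess S y))
        - gaussianTail (channelConst p * |excess S y|)|
      ≤ |(noiseLaw p x).real (errorSet p (excess S x))
        - gaussianTail (channelConst p * |excess S x|)| := fun k => by
    obtain ⟨x, -, hx⟩ := Finset.exists_max_image Finset.univ (fun y : Fin (N k) → ℤˣ =>
      |(noiseLaw p y).real (errorSet p (excess S y))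
        - gaussianTail (channelConst p * |excess S y|)|) Finset.univ_nonempty
    exact ⟨x, fun y => hx y (Finset.mem_univ y)⟩
  choose x hx using hmax
  filter_upwards [eventually_forall_abs_sub_le (tendsto_noiseLaw hp0 hp hN x) hε] with k hk y
  refine (hx k y).trans ?_
  rcases (excess_ne_zero (hNS k) (x k)).lt_or_gt with h | h
  · rw [errorSet_of_neg h, gaussianTail_eq_measureReal_Ici]
    exact (hk _).2
  · rw [errorSet_of_pos h, gaussianTail_eq_measureReal_Iic_neg]
    exact (hk _).1

lemma measurableSingletonClass_units_int : MeasurableSingletonClass ℤˣ where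
  measurableSet_singleton a := by
    refine ⟨{(a : ℤ)}, measurableSet_singleton _, ?_⟩
    ext b
    simp [Units.ext_iff]

section NoisyIsing

variable {n : ℕ} {Ω : Type*} [MeasurableSpace Ω] {P : Measure Ω} [IsProbabilityMeasure P]
  {X Y : Ω → Fin n → ℤˣ} {G : SimpleGraph (Fin n)} {β h p S : ℝ}

/-- Condition on `X`: the joint masses factor through the channel, and the error event depends on
`Y` only through the noise. -/
lemma IsNoisyIsing.errorProb_eq (hXY : IsNoisyIsing P X Y G β h p) (hp0 : 0 < p) (hp : p < 1 / 2)
    (hn : ∀ m : ℤ, (n : ℝ) * (1 + S) / 2 ≠ m) :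
    errorProb P X Y p S
      = ∑ x, P.real {ω | X ω = x} * (noiseLaw p x).real (errorSet p (excess S x)) := by
  classical
  have := measurableSingletonClass_units_int
  have hn0 : n ≠ 0 := fun h => hn 0 (by simp [h])
  have hm : ∀ z : (Fin n → ℤˣ) × (Fin n → ℤˣ), MeasurableSet ((fun ω => (X ω, Y ω)) ⁻¹' {z}) :=
    fun z => (hXY.measurable_sentiment.prodMk hXY.measurable_measured) (measurableSet_singleton z)
  have h1 := sum_measureReal_preimage_singleton (μ := P)
    (Finset.univ.filter fun z : (Fin n → ℤˣ) × (Fin n → ℤˣ) => supermajority S z.1 ≠ detector p S z.2)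
    (f := fun ω => (X ω, Y ω)) fun z _ => hm z
  have h2 : errorProb P X Y p S = P.real ((fun ω => (X ω, Y ω)) ⁻¹'
      (Finset.univ.filter fun z : (Fin n → ℤˣ) × (Fin n → ℤˣ) =>
        supermajority S z.1 ≠ detector p S z.2 : Finset _)) := by
    rw [errorProb]; congr 1; ext ω; simp
  rw [h2, ← h1, Finset.sum_filter, Fintype.sum_prod_type]
  refine Finset.sum_congr rfl fun x _ => ?_
  rw [noiseLaw_real hp0 hp x (measurableSet_errorSet (excess_ne_zero hn x)), Finset.mul_sum]
  refine Finset.sum_congr rfl fun y _ => ?_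
  simp only [noise_mem_errorSet_iff hp0 hp hn0]
  split_ifs
  · rw [channelProb, ← hXY.channel]
    congr 1; ext ω; simp
  · simp

lemma IsNoisyIsing.integral_comp_excess (hXY : IsNoisyIsing P X Y G β h p) (f : ℝ → ℝ) :
    ∫ ω, f (excess S (X ω)) ∂P = ∑ x, P.real {ω | X ω = x} * f (excess S x) := by
  have := measurableSingletonClass_units_int
  have hf : Measurable fun x : Fin n → ℤˣ => f (excess S x) := measurable_of_countable _
  rw [← integral_map (φ := X) (f := fun x => f (excess S x)) hXY.measurable_sentiment.aemeasurable
    hf.aestronglyMeasurable]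
  have := Measure.isProbabilityMeasure_map (μ := P) hXY.measurable_sentiment.aemeasurable
  rw [integral_fintype .of_finite]
  refine Finset.sum_congr rfl fun x _ => ?_
  rw [map_measureReal_apply hXY.measurable_sentiment (measurableSet_singleton x), smul_eq_mul]
  rfl

lemma IsNoisyIsing.abs_errorProb_sub_integral_le (hXY : IsNoisyIsing P X Y G β h p) (hp0 : 0 < p)
    (hp : p < 1 / 2) (hn : ∀ m : ℤ, (n : ℝ) * (1 + S) / 2 ≠ m) {ε : ℝ}
    (hε : ∀ x : Fin n → ℤˣ, |(noiseLaw p x).real (errorSet p (excess S x))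
      - gaussianTail (channelConst p * |excess S x|)| ≤ ε) :
    |errorProb P X Y p S - ∫ ω, gaussianTail (channelConst p * |excess S (X ω)|) ∂P| ≤ ε := by
  have hsum : ∑ x, P.real {ω | X ω = x} = 1 := by
    simpa using (hXY.integral_comp_excess (S := S) fun _ => 1).symm
  rw [hXY.errorProb_eq hp0 hp hn,
    hXY.integral_comp_excess fun u => gaussianTail (channelConst p * |u|),
    ← Finset.sum_sub_distrib]
  calc _ ≤ ∑ x, P.real {ω | X ω = x} * ε := by
        refine (Finset.abs_sum_le_sum_abs _ _).trans (Finset.sum_le_sum fun x _ => ?_)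
        rw [← mul_sub, abs_mul, abs_of_nonneg measureReal_nonneg]
        exact mul_le_mul_of_nonneg_left (hε x) measureReal_nonneg
    _ = ε := by rw [← Finset.sum_mul, hsum, one_mul]

end NoisyIsing

lemma tendsto_errorProb {β h p S : ℝ} (hp0 : 0 < p) (hp : p < 1 / 2) {N : ℕ → ℕ}
    (hN : Tendsto N atTop atTop) (hNS : ∀ k, ∀ m : ℤ, (N k : ℝ) * (1 + S) / 2 ≠ m)
    {G : ∀ k, SimpleGraph (Fin (N k))} {Ω : ℕ → Type*} [∀ k, MeasurableSpace (Ω k)]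
    {P : ∀ k, Measure (Ω k)} [∀ k, IsProbabilityMeasure (P k)]
    {X Y : ∀ k, Ω k → Fin (N k) → ℤˣ} (hXY : ∀ k, IsNoisyIsing (P k) (X k) (Y k) (G k) β h p)
    {Φ : Measure ℝ} [IsProbabilityMeasure Φ]
    (hΦ : TendstoInDistribution (fun k ω => √(N k : ℝ) * (avg (X k ω) - S)) atTop
      (id : ℝ → ℝ) P Φ) :
    Tendsto (fun k => errorProb (P k) (X k) (Y k) p S) atTop
      (𝓝 (∫ x, gaussianTail (channelConst p * |x|) ∂Φ)) := by
  have hcont := continuous_gaussianTail_mul_abs (channelConst p)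
  -- The test function for weak convergence; values in `[0, 1]` give the bound 1.
  let f : BoundedContinuousFunction ℝ ℝ := .ofNormedAddCommGroup
    (fun x => gaussianTail (channelConst p * |x|)) hcont 1 fun x => by
      rw [Real.norm_of_nonneg (gaussianTail_nonneg _)]; exact gaussianTail_le_one _
  have h1 : Tendsto (fun k => ∫ ω, gaussianTail (channelConst p * |excess S (X k ω)|) ∂(P k)) atTop
      (𝓝 (∫ x, gaussianTail (channelConst p * |x|) ∂Φ)) := by
    have h := ProbabilityMeasure.tendsto_iff_forall_integral_tendsto.1 hΦ.tendsto f
    simp only [ProbabilityMeasure.coe_mk, Measure.map_id] at h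
    refine h.congr fun k => ?_
    exact integral_map (hΦ.forall_aemeasurable k) hcont.aestronglyMeasurable
  have h2 : Tendsto (fun k => errorProb (P k) (X k) (Y k) p S
      - ∫ ω, gaussianTail (channelConst p * |excess S (X k ω)|) ∂(P k)) atTop (𝓝 0) := by
    rw [Metric.tendsto_nhds]
    intro ε hε
    filter_upwards [eventually_forall_abs_noiseLaw_sub_le hp0 hp hN hNS (half_pos hε)] with k hk
    rw [Real.dist_eq, sub_zero]
    exact ((hXY k).abs_errorProb_sub_integral_le hp0 hp (hNS k) hk).trans_lt (half_lt_self hε)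
  simpa using h2.add h1

end Sentiment

end

theorem mainTheorem5
    (β h p S : ℝ) (hβ : 0 < β) (hp0 : 0 < p) (hp : p < 1 / 2) (hS : S ∈ Set.Ioo (-1 : ℝ) 1)
    -- the numbers of members, with `n (1 + S) / 2` never an integer
    (N : ℕ → ℕ) (hN : Tendsto N atTop atTop)
    (hNS : ∀ k, ∀ m : ℤ, (N k : ℝ) * (1 + S) / 2 ≠ m)
    (G : ∀ k, SimpleGraph (Fin (N k)))
    {Ω : ℕ → Type*} [∀ k, MeasurableSpace (Ω k)]
    (P : ∀ k, Measure (Ω k)) [∀ k, IsProbabilityMeasure (P k)]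
    (X Y : ∀ k, Ω k → Fin (N k) → ℤˣ)
    (hXY : ∀ k, Sentiment.IsNoisyIsing (P k) (X k) (Y k) (G k) β h p) :
    (∀ (Φ : Measure ℝ) [IsProbabilityMeasure Φ],
      TendstoInDistribution (fun k ω => √(N k : ℝ) * (Sentiment.avg (X k ω) - S)) atTop
        (id : ℝ → ℝ) P Φ →
      Tendsto (fun k => Sentiment.errorProb (P k) (X k) (Y k) p S) atTop
        (𝓝 (∫ x, Sentiment.gaussianTail (Sentiment.channelConst p * |x|) ∂Φ))) ∧
    (∀ σ : ℝ≥0,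
      TendstoInDistribution (fun k ω => √(N k : ℝ) * (Sentiment.avg (X k ω) - S)) atTop
        (id : ℝ → ℝ) P (gaussianReal 0 (σ ^ 2)) →
      Tendsto (fun k => Sentiment.errorProb (P k) (X k) (Y k) p S) atTop
        (𝓝 (1 / Real.pi * Sentiment.arccot (Sentiment.channelConst p * σ))) ∧
      0 < 1 / Real.pi * Sentiment.arccot (Sentiment.channelConst p * σ)) := by
  refine ⟨fun Φ _ hΦ => Sentiment.tendsto_errorProb hp0 hp hN hNS hXY hΦ, fun σ hσ => ⟨?_, ?_⟩⟩
  · rw [← Sentiment.integral_gaussianTail_gaussianReal]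
    exact Sentiment.tendsto_errorProb hp0 hp hN hNS hXY hσ
  · exact mul_pos (by positivity) (Sentiment.arccot_pos _)
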